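/- Let $X(1),X(2),\dots$ be real random variables on a probability space, put $S(n)=X(1)+\cdots+X(n)$, fix an integer $B\ge 1$, and define the block sums $Y(i)=\sum_{j=(i-1)B+1}^{iB}X(j)$, $i\ge1$. Suppose that the $Y(i)$ are independent and identically distributed and take values in a closed bounded set $\Sigma\subset\mathbb R$ that is disjoint from some open ball around $0$. For $n\ge B$ and $\theta\in\mathbb R$ let $$\hat\lambda(n,\theta)=\frac1B\log\Bigl(\frac1{\lfloor n/B\rfloor}\sum_{i=1}^{\lfloor n/B\rfloor}e^{\theta Y(i)}\Bigr),\qquad \theta^*(n)=\sup\{\theta\in\mathbb R:\hat\lambda(n,\theta)\le0\}\in[0,\infty].$$ Let $\lambda_B(\theta)=B^{-1}\log E[e^{\theta Y(1)}]$ and $\theta^*=\sup\{\theta\in\mathbb R:\lambda_B(\theta)\le0\}\in[0,\infty]$. Then every $\theta^*(n)$ is a random variable, and the following hold. (a) There is a good rate function $J:[0,\infty]\to[0,\infty]$ (that is, $J$ is lower semicontinuous and its level sets $\{J\le a\}$, $0\le a<\infty$, are compact) such that $\{\theta^*(n)\}$ satisfies the large deviation principle at speed $n$ with rate function $J$: for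 every Borel set $A\subset[0,\infty]$, with interior $A^\circ$ and closure $\bar A$, $$-\inf_{x\in A^\circ}J(x)\le\liminf_{n\to\infty}\frac1n\log P(\theta^*(n)\in A)\le\limsup_{n\to\infty}\frac1n\log P(\theta^*(n)\in A)\le-\inf_{x\in\bar A}J(x).$$ (b) The estimates are consistent: $J(x)=0$ if and only if $x=\theta^*$. (c) $\theta^*$ is Loynes' exponent of $\{X(n)\}$: $\lim_{k\to\infty}\frac1{kB}\log E[e^{\theta S(kB)}]=\lambda_B(\theta)$ for every $\theta\in\mathbb R$. Consequently, if for every $\theta\in\mathbb R$ the limit $\lambda(\theta)=\lim_{n\to\infty}\frac1n\log E[e^{\theta S(n)}]$ along all $n$ exists in $[-\infty,\infty]$, then $\lambda=\lambda_B$ and $\theta^*=\sup\{\theta\in\mathbb R:\lambda(\theta)\le0\}$, so that $J(x)=0$ if and only if $x=\sup\{\theta\in\mathbb R:\lambda(\theta)\le 0\}$. -/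

import Mathlib

open MeasureTheory ProbabilityTheory Filter Topology
open scoped ENNReal NNReal

noncomputable section

namespace Loynes

/-- `J : X → [0, ∞]` is a good rate function: it is lower semicontinuous and all its
level sets `{x | J x ≤ a}`, `0 ≤ a < ∞`, are compact. -/
structure IsGoodRateFunction {E : Type*} [TopologicalSpace E] (J : E → ℝ≥0∞) : Prop where
  lowerSemicontinuous : LowerSemicontinuous J
  isCompact_level : ∀ a : ℝ≥0, IsCompact {x | J x ≤ a}

/-- The random elements `Z 0, Z 1, Z 2, …` satisfy the large deviation principle, at speed `n`,
with rate function `J`. Logarithms and limits are taken in the extended reals, so that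
`log 0 = -∞`, and the infimum over the empty set is `∞`. -/
structure SatisfiesLDP {Ω E : Type*} [MeasurableSpace Ω] [TopologicalSpace E] [MeasurableSpace E]
    (P : Measure Ω) (Z : ℕ → Ω → E) (J : E → ℝ≥0∞) : Prop where
  lower : ∀ A : Set E, MeasurableSet A →
    -((⨅ x ∈ interior A, J x : ℝ≥0∞) : EReal)
      ≤ liminf (fun n : ℕ => ENNReal.log (P {ω | Z n ω ∈ A}) / (n : EReal)) atTop
  upper : ∀ A : Set E, MeasurableSet A →
    limsup (fun n : ℕ => ENNReal.log (P {ω | Z n ω ∈ A}) / (n : EReal)) atTop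
      ≤ -((⨅ x ∈ closure A, J x : ℝ≥0∞) : EReal)

/-- `sup {θ ∈ ℝ : Λ θ ≤ 0}` as an element of `[0, ∞]`; the supremum itself is taken in
`[-∞, ∞]`, and it is nonnegative as soon as `Λ 0 ≤ 0`, see `coe_tailExponent`. -/
def tailExponent (Λ : ℝ → EReal) : ℝ≥0∞ :=
  (sSup (Real.toEReal '' {θ : ℝ | Λ θ ≤ 0})).toENNReal

theorem coe_tailExponent {Λ : ℝ → EReal} (h : Λ 0 ≤ 0) :
    (tailExponent Λ : EReal) = sSup (Real.toEReal '' {θ : ℝ | Λ θ ≤ 0}) :=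
  EReal.coe_toENNReal (le_sSup ⟨0, h, rfl⟩)

variable {Ω : Type*}

/-- The partial sum of the first `n` increments (`X 0` is the first increment). -/
def partialSum (X : ℕ → Ω → ℝ) (n : ℕ) (ω : Ω) : ℝ :=
  ∑ j ∈ Finset.range n, X j ω

/-- The sum of the increments over the `i`-th block of length `B` (blocks and increments are both
counted from `0`). -/
def block (X : ℕ → Ω → ℝ) (B i : ℕ) (ω : Ω) : ℝ :=
  ∑ j ∈ Finset.range B, X (i * B + j) ω

/-- `(1 / n) log E[exp (θ S(n))]`, where the expectation may be `∞`. -/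
def scaledCGF [MeasurableSpace Ω] (P : Measure Ω) (X : ℕ → Ω → ℝ) (n : ℕ) (θ : ℝ) : EReal :=
  ENNReal.log (∫⁻ ω, ENNReal.ofReal (Real.exp (θ * partialSum X n ω)) ∂P) / (n : EReal)

/-- `Λ` is the scaled cumulant generating function of the increments: for every `θ` the limit of
`(1 / n) log E[exp (θ S(n))]` exists in `[-∞, ∞]` and is `Λ θ`. -/
def IsSCGF [MeasurableSpace Ω] (P : Measure Ω) (X : ℕ → Ω → ℝ) (Λ : ℝ → EReal) : Prop :=
  ∀ θ : ℝ, Tendsto (fun n : ℕ => scaledCGF P X n θ) atTop (𝓝 (Λ θ))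

/-- `B⁻¹ log E[exp (θ Y(1))]`, where `Y(1)` is the first block sum. -/
def blockCGF [MeasurableSpace Ω] (P : Measure Ω) (X : ℕ → Ω → ℝ) (B : ℕ) (θ : ℝ) : ℝ :=
  (B : ℝ)⁻¹ * cgf (block X B 0) P θ

/-- The estimate of the cumulant generating function from the first `n` increments. It is
meaningful for `n ≥ B`, when at least one complete block has been observed. -/
def cgfEstimator (X : ℕ → Ω → ℝ) (B n : ℕ) (ω : Ω) (θ : ℝ) : ℝ :=
  (B : ℝ)⁻¹ * Real.log
    (((n / B : ℕ) : ℝ)⁻¹ * ∑ i ∈ Finset.range (n / B), Real.exp (θ * block X B i ω))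

/-- The estimate of Loynes' exponent from the first `n` increments. -/
def exponentEstimator (X : ℕ → Ω → ℝ) (B n : ℕ) (ω : Ω) : ℝ≥0∞ :=
  tailExponent (fun θ => (cgfEstimator X B n ω θ : EReal))

end Loynes

end

/-!
For real `y > 0`, convexity of `θ ↦ ∑ i < m, (exp (θ Y i) - 1)`, which vanishes at `0`, turns events
about the estimator into events about sums of bounded i.i.d. variables: with `m = n / B` complete
blocks, `y ≤ θ*(n)` if and only if `∑ i < m, (exp (y Y i) - 1) ≤ 0`
(`coe_le_exponentEstimator_iff`). The large deviation principle is built from these half-lines,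
with no explicit formula for the rate function.

* *Rates exist.* The probabilities `P (y ≤ θ*(n))` and `P (θ*(n) < y)` are supermultiplicative in
  the number of blocks, because `(-∞, 0]` and `(0, ∞)` are closed under addition. By Fekete's lemma
  they have exponential rates `U y` and `L y` in `[0, ∞]` (`exists_tendsto_log_prob_sum_mem`).
* *Rate function.* `J x` is the supremum of `U y` over `y < x` and of `L y` over `y > x`
  (`halfLineRate`). It is a supremum of multiples of indicators of open sets, hence lower
  semicontinuous, and `[0, ∞]` is compact. The upper bound follows by covering the closure of the
  event with finitely many half-lines.
* *Strict monotonicity.* The lower bound on `(y, z)` compares `P (y ≤ θ*(n))` with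
  `P (z ≤ θ*(n))`, so it needs `U y < U z`. This can fail only if `U z = 0`, when the events
  `θ*(n) < z` and `θ*(n) < y` serve instead, or if `U y = ∞`, when there is nothing to show. Since
  the values of the blocks lie in a compact set avoiding `0`, strict convexity holds with a uniform
  gap `δ` per block. The gap pays for a fixed proportion of additional blocks with arbitrary values:
  `z ≤ θ*` after `N j` blocks forces `y ≤ θ*` after `(N + 1) j` blocks. Hence
  `(N + 1) U y ≤ N U z` (`rate_lt_of_le_comp`); likewise for `L`.
* *Zeros.* Hoeffding's inequality gives `U y > 0` for `y` above the true exponent and `L y > 0`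
  below it. As the two probabilities add up to one, `U y` or `L y` is always zero, so `J` vanishes
  at the true exponent and nowhere else.
-/

namespace Loynes

/-! ### Exponential growth rates -/

/-- Fekete's lemma for supermultiplicative sequences in `[0, 1]`. The sequence may vanish, provided
that `u 1 = 0` makes it vanish from `1` on; the value `u 0` is unconstrained. -/
theorem exists_tendsto_log_div_of_supermultiplicative {u : ℕ → ℝ≥0∞}
    (hmul : ∀ m n, u m * u n ≤ u (m + n)) (hle : ∀ n, u n ≤ 1)
    (hzero : u 1 = 0 → ∀ n, 1 ≤ n → u n = 0) :
    ∃ r : ℝ≥0∞, Tendsto (fun n : ℕ => ENNReal.log (u n) / (n : EReal)) atTop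
      (𝓝 (-(r : EReal))) := by
  by_cases h1 : u 1 = 0
  · refine ⟨∞, tendsto_const_nhds.congr' ?_⟩
    filter_upwards [eventually_ge_atTop 1] with n hn
    rw [hzero h1 n hn, ENNReal.log_zero, EReal.bot_div_of_pos_ne_top
      (by exact_mod_cast hn) (EReal.natCast_ne_top n)]
    rfl
  have hpos : ∀ n, u (n + 1) ≠ 0 := by
    intro n
    induction n with
    | zero => exact h1
    | succ n ih => exact ((pos_iff_ne_zero.mpr (mul_ne_zero ih h1)).trans_le (hmul _ _)).ne'
  have hfin : ∀ n, u n ≠ ∞ := fun n => ((hle n).trans_lt ENNReal.one_lt_top).ne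
  set a : ℕ → ℝ := fun n => -Real.log (u n).toReal with ha
  have ha0 : ∀ n, 0 ≤ a n := fun n => by
    have : (u n).toReal ≤ 1 := by simpa using ENNReal.toReal_mono ENNReal.one_ne_top (hle n)
    have := Real.log_nonpos ENNReal.toReal_nonneg this
    simp only [ha]; linarith
  have hsub : Subadditive a := by
    intro m n
    rcases m with _ | m
    · rw [zero_add]; linarith [ha0 0]
    rcases n with _ | n
    · rw [add_zero]; linarith [ha0 0]
    have p1 := ENNReal.toReal_pos (hpos m) (hfin _)
    have p2 := ENNReal.toReal_pos (hpos n) (hfin _)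
    have := ENNReal.toReal_mono (hfin _) (hmul (m + 1) (n + 1))
    rw [ENNReal.toReal_mul] at this
    have := Real.log_le_log (mul_pos p1 p2) this
    rw [Real.log_mul p1.ne' p2.ne'] at this
    simp only [ha]; linarith
  have hlim := hsub.tendsto_lim
    ⟨0, by rintro _ ⟨n, rfl⟩; exact div_nonneg (ha0 n) n.cast_nonneg⟩
  have hlim0 : 0 ≤ hsub.lim := ge_of_tendsto' hlim fun n => div_nonneg (ha0 n) n.cast_nonneg
  refine ⟨ENNReal.ofReal hsub.lim, ?_⟩
  rw [EReal.coe_ennreal_ofReal, max_eq_left hlim0, ← EReal.coe_neg]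
  refine ((continuous_coe_real_ereal.tendsto _).comp hlim.neg).congr' ?_
  filter_upwards [eventually_ge_atTop 1] with n hn
  obtain ⟨k, rfl⟩ : ∃ k, n = k + 1 := ⟨n - 1, by omega⟩
  rw [ENNReal.log_pos_real (hpos k) (hfin _)]
  simp only [Function.comp, ha]
  rw [neg_div, neg_neg, EReal.coe_div]
  rfl

/-- A summand that grows strictly more slowly than `u` can be discarded from an upper bound on `u`. -/
theorem expGrowthInf_le_of_le_add {u v w : ℕ → ℝ≥0∞} (h : ∀ n, u n ≤ w n + v n)
    (hlt : ExpGrowth.expGrowthSup v < ExpGrowth.expGrowthInf u) :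
    ExpGrowth.expGrowthInf u ≤ ExpGrowth.expGrowthInf w := by
  have h2 : ExpGrowth.expGrowthInf u ≤ ExpGrowth.expGrowthInf (w ⊔ v) := by
    refine ExpGrowth.expGrowthInf_le_of_eventually_le (b := 2) (by simp)
      (Eventually.of_forall fun n => (h n).trans ?_)
    rw [Pi.sup_apply, two_mul]
    exact add_le_add le_sup_left le_sup_right
  by_contra! hcon
  obtain ⟨b, hb1, hb2⟩ := exists_between (max_lt hcon hlt)
  have hfr : ∃ᶠ n : ℕ in atTop, w n ≤ EReal.exp (b * n) :=
    ExpGrowth.frequently_le_exp ((le_max_left _ _).trans_lt hb1)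
  have hev : ∀ᶠ n : ℕ in atTop, v n ≤ EReal.exp (b * n) :=
    ExpGrowth.eventually_le_exp ((le_max_right _ _).trans_lt hb1)
  have := (hfr.and_eventually hev).mono fun n hn => sup_le hn.1 hn.2
  exact absurd (h2.trans (Frequently.expGrowthInf_le this)) (not_le.mpr hb2)

/-! ### A large deviation principle from half-lines -/

/-- The rate function determined by the rates `U y` of the events `y ≤ Z` and the rates `L y` of the
events `Z < y`: the supremum of all `U y` with `y < x` and all `L y` with `x < y`. Taking only
`y ≠ x` makes it lower semicontinuous whatever `U` and `L` are. -/
noncomputable def halfLineRate (U L : ℝ≥0 → ℝ≥0∞) (x : ℝ≥0∞) : ℝ≥0∞ :=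
  ⨆ y : ℝ≥0, (Set.Ioi (y : ℝ≥0∞)).indicator (fun _ => U y) x ⊔
    (Set.Iio (y : ℝ≥0∞)).indicator (fun _ => L y) x

section halfLine

variable {U L : ℝ≥0 → ℝ≥0∞}

theorem le_halfLineRate_of_lt {y : ℝ≥0} {x : ℝ≥0∞} (h : (y : ℝ≥0∞) < x) :
    U y ≤ halfLineRate U L x := by
  refine le_trans ?_ (le_iSup _ y)
  refine le_trans ?_ le_sup_left
  rw [Set.indicator_of_mem (by exact h)]

theorem le_halfLineRate_of_gt {y : ℝ≥0} {x : ℝ≥0∞} (h : x < (y : ℝ≥0∞)) :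
    L y ≤ halfLineRate U L x := by
  refine le_trans ?_ (le_iSup _ y)
  refine le_trans ?_ le_sup_right
  rw [Set.indicator_of_mem (by exact h)]

theorem exists_of_lt_halfLineRate {a x : ℝ≥0∞} (h : a < halfLineRate U L x) :
    ∃ y : ℝ≥0, ((y : ℝ≥0∞) < x ∧ a < U y) ∨ (x < (y : ℝ≥0∞) ∧ a < L y) := by
  obtain ⟨y, hy⟩ := lt_iSup_iff.mp h
  refine ⟨y, (lt_sup_iff.mp hy).imp ?_ ?_⟩ <;> intro h
  · by_cases hx : (y : ℝ≥0∞) < x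
    · exact ⟨hx, by rwa [Set.indicator_of_mem (by exact hx)] at h⟩
    · simp [hx] at h
  · by_cases hx : x < (y : ℝ≥0∞)
    · exact ⟨hx, by rwa [Set.indicator_of_mem (by exact hx)] at h⟩
    · simp [hx] at h

theorem isGoodRateFunction_halfLineRate : IsGoodRateFunction (halfLineRate U L) := by
  have h : LowerSemicontinuous (halfLineRate U L) :=
    lowerSemicontinuous_iSup fun y =>
      (isOpen_Ioi.lowerSemicontinuous_indicator (zero_le)).sup
        (isOpen_Iio.lowerSemicontinuous_indicator (zero_le))
  exact ⟨h, fun a => (h.isClosed_preimage (a : ℝ≥0∞)).isCompact⟩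

variable {Ω : Type*} [MeasurableSpace Ω] {P : Measure Ω}

theorem expGrowthSup_prob_union_le {α : Type*} (s t : Set α) (Z : ℕ → Ω → α) :
    ExpGrowth.expGrowthSup (fun n => P {ω | Z n ω ∈ s ∪ t}) ≤
      ExpGrowth.expGrowthSup (fun n => P {ω | Z n ω ∈ s}) ⊔
        ExpGrowth.expGrowthSup (fun n => P {ω | Z n ω ∈ t}) := by
  rw [← ExpGrowth.expGrowthSup_add]
  exact ExpGrowth.expGrowthSup_monotone fun n => measure_union_le {ω | Z n ω ∈ s} {ω | Z n ω ∈ t}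

/-- An exponential upper bound that holds near every point of a compact set holds for the set. -/
theorem expGrowthSup_prob_le_of_isCompact {α : Type*} [TopologicalSpace α] {K : Set α}
    (hK : IsCompact K) (Z : ℕ → Ω → α) {b : EReal}
    (h : ∀ x ∈ K, ∃ t ∈ 𝓝 x, ExpGrowth.expGrowthSup (fun n => P {ω | Z n ω ∈ t}) ≤ b) :
    ExpGrowth.expGrowthSup (fun n => P {ω | Z n ω ∈ K}) ≤ b := by
  refine hK.induction_on
    (p := fun s => ExpGrowth.expGrowthSup (fun n => P {ω | Z n ω ∈ s}) ≤ b) ?_ ?_ ?_ ?_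
  · have : (fun n => P {ω | Z n ω ∈ (∅ : Set α)}) = 0 := by ext n; simp
    rw [this, ExpGrowth.expGrowthSup_zero]
    exact bot_le
  · intro s t hst ht
    exact (ExpGrowth.expGrowthSup_monotone fun n =>
      measure_mono (μ := P) fun ω (hω : Z n ω ∈ s) => hst hω).trans ht
  · intro s t hs ht
    exact (expGrowthSup_prob_union_le s t Z).trans (sup_le hs ht)
  · intro x hx
    obtain ⟨t, ht, hle⟩ := h x hx
    exact ⟨t, mem_nhdsWithin_of_mem_nhds ht, hle⟩

/-- A large deviation principle on `[0, ∞]` from half-lines: it suffices that the events `y ≤ Z n`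
and `Z n < y` have exponential rates `U y` and `L y`, that these are strictly monotone wherever they
are positive and finite, and that `U` is positive to the right of `t` and `L` to the left. -/
theorem satisfiesLDP_halfLineRate [IsProbabilityMeasure P] {Z : ℕ → Ω → ℝ≥0∞}
    (hZ : ∀ n, Measurable (Z n)) {t : ℝ≥0∞}
    (hU : ∀ y : ℝ≥0, Tendsto (fun n : ℕ => ENNReal.log (P {ω | (y : ℝ≥0∞) ≤ Z n ω}) / (n : EReal))
      atTop (𝓝 (-(U y : EReal))))
    (hL : ∀ y : ℝ≥0, Tendsto (fun n : ℕ => ENNReal.log (P {ω | Z n ω < (y : ℝ≥0∞)}) / (n : EReal))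
      atTop (𝓝 (-(L y : EReal))))
    (hUs : ∀ y z : ℝ≥0, 0 < y → y < z → U z ≠ 0 → U y ≠ ∞ → U y < U z)
    (hLs : ∀ y z : ℝ≥0, 0 < y → y < z → L y ≠ 0 → L z ≠ ∞ → L z < L y)
    (hU0 : ∀ y : ℝ≥0, t < y → U y ≠ 0) (hL0 : ∀ y : ℝ≥0, (y : ℝ≥0∞) < t → L y ≠ 0) :
    SatisfiesLDP P Z (halfLineRate U L) ∧ ∀ x, halfLineRate U L x = 0 ↔ x = t := by
  have hUi (y : ℝ≥0) : ExpGrowth.expGrowthInf (fun n => P {ω | (y : ℝ≥0∞) ≤ Z n ω}) =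
    -(U y : EReal) := (hU y).liminf_eq
  have hUu (y : ℝ≥0) : ExpGrowth.expGrowthSup (fun n => P {ω | (y : ℝ≥0∞) ≤ Z n ω}) =
    -(U y : EReal) := (hU y).limsup_eq
  have hLi (y : ℝ≥0) : ExpGrowth.expGrowthInf (fun n => P {ω | Z n ω < (y : ℝ≥0∞)}) =
    -(L y : EReal) := (hL y).liminf_eq
  have hLu (y : ℝ≥0) : ExpGrowth.expGrowthSup (fun n => P {ω | Z n ω < (y : ℝ≥0∞)}) =
    -(L y : EReal) := (hL y).limsup_eq
  -- The two probabilities add up to one, so they cannot both decay exponentially.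
  have hUL (y : ℝ≥0) : U y = 0 ∨ L y = 0 := by
    have h1 : (fun n => P {ω | (y : ℝ≥0∞) ≤ Z n ω}) + (fun n => P {ω | Z n ω < (y : ℝ≥0∞)}) =
        fun _ => 1 := by
      funext n
      have hm : MeasurableSet {ω | (y : ℝ≥0∞) ≤ Z n ω} := hZ n measurableSet_Ici
      have := prob_add_prob_compl (μ := P) hm
      rwa [show {ω | (y : ℝ≥0∞) ≤ Z n ω}ᶜ = {ω | Z n ω < (y : ℝ≥0∞)} by ext; simp] at this
    have h2 := congrArg ExpGrowth.expGrowthSup h1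
    rw [ExpGrowth.expGrowthSup_add, hUu, hLu,
      ExpGrowth.expGrowthSup_const one_ne_zero ENNReal.one_ne_top] at h2
    rcases max_choice (-(U y : EReal)) (-(L y : EReal)) with h | h <;> rw [h] at h2
    · left; simpa using h2
    · right; simpa using h2
  have hEle {a b : ℝ≥0∞} (h : a ≤ b) : -(b : EReal) ≤ -(a : EReal) :=
    EReal.neg_le_neg_iff.mpr (EReal.coe_ennreal_le_coe_ennreal_iff.mpr h)
  have hElt {a b : ℝ≥0∞} (h : a < b) : -(b : EReal) < -(a : EReal) :=
    EReal.neg_lt_neg_iff.mpr (EReal.coe_ennreal_lt_coe_ennreal_iff.mpr h)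
  refine ⟨⟨?_, ?_⟩, ?_⟩
  · intro A _
    change _ ≤ ExpGrowth.expGrowthInf (fun n => P {ω | Z n ω ∈ A})
    have hx : ∀ x ∈ interior A,
        -((halfLineRate U L x : ℝ≥0∞) : EReal) ≤
          ExpGrowth.expGrowthInf (fun n => P {ω | Z n ω ∈ A}) := by
      intro x hxA
      have hnhds : A ∈ 𝓝 x := mem_interior_iff_mem_nhds.mp hxA
      by_cases htop : halfLineRate U L x = ∞
      · rw [htop]; exact bot_le
      rcases eq_or_ne x 0 with rfl | hx0
      · obtain ⟨b, hb, hbA⟩ := exists_Ico_subset_of_mem_nhds hnhds ⟨1, zero_lt_one⟩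
        obtain ⟨z, hz0, hzb⟩ := ENNReal.lt_iff_exists_nnreal_btwn.mp hb
        calc _ ≤ -(L z : EReal) := hEle (le_halfLineRate_of_gt hz0)
          _ ≤ _ := by
            rw [← hLi]
            exact ExpGrowth.expGrowthInf_monotone fun n => measure_mono fun ω hω =>
              hbA ⟨zero_le, lt_trans hω hzb⟩
      rcases eq_or_ne x ∞ with rfl | hxt
      · obtain ⟨b, hb, hbA⟩ := exists_Ioc_subset_of_mem_nhds hnhds ⟨0, ENNReal.zero_lt_top⟩
        obtain ⟨y, hby, hyt⟩ := ENNReal.lt_iff_exists_nnreal_btwn.mp hb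
        calc _ ≤ -(U y : EReal) := hEle (le_halfLineRate_of_lt hyt)
          _ ≤ _ := by
            rw [← hUi]
            exact ExpGrowth.expGrowthInf_monotone fun n => measure_mono fun ω hω =>
              hbA ⟨lt_of_lt_of_le hby hω, le_top⟩
      obtain ⟨a, b, ⟨hax, hxb⟩, hab⟩ :=
        (mem_nhds_iff_exists_Ioo_subset' ⟨0, pos_iff_ne_zero.mpr hx0⟩
        ⟨∞, lt_top_iff_ne_top.mpr hxt⟩).mp hnhds
      obtain ⟨y, hay, hyx⟩ := ENNReal.lt_iff_exists_nnreal_btwn.mp hax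
      obtain ⟨z, hxz, hzb⟩ := ENNReal.lt_iff_exists_nnreal_btwn.mp hxb
      have hy0 : 0 < y := by
        have := (zero_le (a := a)).trans_lt hay
        exact_mod_cast this
      have hyz : y < z := by exact_mod_cast hyx.trans hxz
      have hUy : U y ≠ ∞ := ((le_halfLineRate_of_lt hyx).trans_lt (lt_top_iff_ne_top.mpr htop)).ne
      have hLz : L z ≠ ∞ := ((le_halfLineRate_of_gt hxz).trans_lt (lt_top_iff_ne_top.mpr htop)).ne
      -- If `U z = 0`, then `z ≤ t`, and the event is bounded below through the left half-lines.
      by_cases hUz0 : U z = 0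
      · have hLy0 : L y ≠ 0 := by
          intro hLy0
          have h1 : ¬ (y : ℝ≥0∞) < t := fun h => hL0 y h hLy0
          have h2 : ¬ t < (z : ℝ≥0∞) := fun h => hU0 z h hUz0
          exact absurd ((not_lt.mp h2).trans (not_lt.mp h1)) (not_le.mpr (by exact_mod_cast hyz))
        have hlt := hLs y z hy0 hyz hLy0 hLz
        calc _ ≤ -(L z : EReal) := hEle (le_halfLineRate_of_gt hxz)
          _ ≤ _ := by
            rw [← hLi]
            refine expGrowthInf_le_of_le_add (v := fun n => P {ω | Z n ω < (y : ℝ≥0∞)})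
              (fun n => (measure_mono ?_).trans (measure_union_le _ _)) ?_
            · intro ω hω
              by_cases h : Z n ω < (y : ℝ≥0∞)
              · exact Or.inr h
              · exact Or.inl (hab ⟨hay.trans_le (not_lt.mp h), lt_trans hω hzb⟩)
            · rw [hLi, hLu]; exact hElt hlt
      · have hlt := hUs y z hy0 hyz hUz0 hUy
        calc _ ≤ -(U y : EReal) := hEle (le_halfLineRate_of_lt hyx)
          _ ≤ _ := by
            rw [← hUi]
            refine expGrowthInf_le_of_le_add (v := fun n => P {ω | (z : ℝ≥0∞) ≤ Z n ω})
              (fun n => (measure_mono ?_).trans (measure_union_le _ _)) ?_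
            · intro ω hω
              by_cases h : (z : ℝ≥0∞) ≤ Z n ω
              · exact Or.inr h
              · exact Or.inl (hab ⟨hay.trans_le hω, (not_le.mp h).trans hzb⟩)
            · rw [hUi, hUu]; exact hElt hlt
    rw [EReal.neg_le]
    refine ((le_max_right 0 _).trans_eq EReal.coe_toENNReal_eq_max.symm).trans
      (EReal.coe_ennreal_le_coe_ennreal_iff.mpr ?_)
    refine le_iInf₂ fun x hxA => ?_
    rw [← EReal.toENNReal_coe (x := halfLineRate U L x)]
    exact EReal.toENNReal_le_toENNReal (EReal.neg_le.mp (hx x hxA))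
  · intro A _
    change ExpGrowth.expGrowthSup (fun n => P {ω | Z n ω ∈ A}) ≤ _
    set E := ExpGrowth.expGrowthSup (fun n => P {ω | Z n ω ∈ A}) with hE
    have hE0 : 0 ≤ -E := by
      rw [EReal.neg_nonneg, hE, ← ExpGrowth.expGrowthSup_const one_ne_zero ENNReal.one_ne_top]
      exact ExpGrowth.expGrowthSup_monotone fun n => prob_le_one
    rw [EReal.le_neg, ← EReal.coe_toENNReal hE0, EReal.coe_ennreal_le_coe_ennreal_iff]
    by_contra! hcon
    obtain ⟨a, hEa, haJ⟩ := exists_between hcon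
    have hK : ExpGrowth.expGrowthSup (fun n => P {ω | Z n ω ∈ closure A}) ≤ -(a : EReal) := by
      refine expGrowthSup_prob_le_of_isCompact isClosed_closure.isCompact Z fun x hx => ?_
      obtain ⟨y, ⟨h, hy⟩ | ⟨h, hy⟩⟩ := exists_of_lt_halfLineRate (haJ.trans_le (iInf₂_le x hx))
      · exact ⟨Set.Ici y, Ici_mem_nhds h, (hUu y).trans_le (hEle hy.le)⟩
      · exact ⟨Set.Iio y, Iio_mem_nhds h, (hLu y).trans_le (hEle hy.le)⟩
    have hsub (n : ℕ) : P {ω | Z n ω ∈ A} ≤ P {ω | Z n ω ∈ closure A} :=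
      measure_mono fun ω (hω : Z n ω ∈ A) => (subset_closure hω : Z n ω ∈ closure A)
    have hEK : E ≤ -(a : EReal) := (ExpGrowth.expGrowthSup_monotone hsub).trans hK
    have := EReal.toENNReal_le_toENNReal (EReal.le_neg.mp hEK)
    rw [EReal.toENNReal_coe] at this
    exact absurd this (not_le.mpr hEa)
  · intro x
    constructor
    · intro hx
      by_contra hne
      rcases lt_or_gt_of_ne hne with h | h
      · obtain ⟨y, hxy, hyt⟩ := ENNReal.lt_iff_exists_nnreal_btwn.mp h
        exact hL0 y hyt (le_antisymm (hx ▸ le_halfLineRate_of_gt hxy) (zero_le))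
      · obtain ⟨y, hty, hyx⟩ := ENNReal.lt_iff_exists_nnreal_btwn.mp h
        exact hU0 y hty (le_antisymm (hx ▸ le_halfLineRate_of_lt hyx) (zero_le))
    · rintro rfl
      by_contra hne
      obtain ⟨y, ⟨h, hy⟩ | ⟨h, hy⟩⟩ := exists_of_lt_halfLineRate (pos_iff_ne_zero.mpr hne)
      · exact (hUL y).elim hy.ne' (hL0 y h)
      · exact (hUL y).elim (hU0 y h) hy.ne'

end halfLine

/-! ### Convexity of exponentials -/

theorem exp_mul_le_of_le {s t : ℝ} (hs : 0 ≤ s) (hst : s ≤ t) (ht : 0 < t) (w : ℝ) :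
    Real.exp (s * w) - 1 ≤ s / t * (Real.exp (t * w) - 1) := by
  have h := convexOn_exp.2 (Set.mem_univ (t * w)) (Set.mem_univ 0)
    (show 0 ≤ s / t by positivity) (show 0 ≤ 1 - s / t by rwa [sub_nonneg, div_le_one ht]) (by ring)
  have e : s / t * (t * w) = s * w := by field_simp
  simp only [smul_eq_mul, mul_zero, add_zero, Real.exp_zero, mul_one, e] at h
  linarith

theorem exp_mul_lt_of_lt {s t : ℝ} (hs : 0 < s) (hst : s < t) {w : ℝ} (hw : w ≠ 0) :
    Real.exp (s * w) - 1 < s / t * (Real.exp (t * w) - 1) := by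
  have ht := hs.trans hst
  have h := strictConvexOn_exp.2 (Set.mem_univ (t * w)) (Set.mem_univ 0)
    (mul_ne_zero ht.ne' hw)
    (show 0 < s / t by positivity) (show 0 < 1 - s / t by rwa [sub_pos, div_lt_one ht]) (by ring)
  have e : s / t * (t * w) = s * w := by field_simp
  simp only [smul_eq_mul, mul_zero, add_zero, Real.exp_zero, mul_one, e] at h
  linarith

/-- Strict convexity of the exponential, with a gap that is uniform over a compact set avoiding `0`. -/
theorem exists_exp_mul_add_le {S : Set ℝ} (hS : IsCompact S) (h0 : (0 : ℝ) ∉ S) {s t : ℝ}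
    (hs : 0 < s) (hst : s < t) :
    ∃ δ : ℝ, 0 < δ ∧ ∀ w ∈ S,
      Real.exp (s * w) - 1 + δ ≤ s / t * (Real.exp (t * w) - 1) := by
  obtain ⟨δ, hδ, h⟩ := hS.exists_forall_le' (a := 0)
    (f := fun w => s / t * (Real.exp (t * w) - 1) - (Real.exp (s * w) - 1))
    (by fun_prop) fun w hw => sub_pos.mpr (exp_mul_lt_of_lt hs hst (ne_of_mem_of_not_mem hw h0))
  exact ⟨δ, hδ, fun w hw => by linarith [h w hw]⟩

/-! ### Tail exponents -/

/-- If `{Λ ≤ 0}` is closed and downward closed among nonnegative numbers, then it contains every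
nonnegative real up to its supremum. -/
theorem coe_le_tailExponent_iff {Λ : ℝ → EReal} (h0 : Λ 0 ≤ 0)
    (hdown : ∀ s t : ℝ, 0 ≤ s → s ≤ t → Λ t ≤ 0 → Λ s ≤ 0) (hcl : IsClosed {θ | Λ θ ≤ 0})
    (y : ℝ≥0) : (y : ℝ≥0∞) ≤ tailExponent Λ ↔ Λ y ≤ 0 := by
  rw [← EReal.coe_ennreal_le_coe_ennreal_iff, coe_tailExponent h0]
  constructor
  · intro h
    rcases eq_or_ne y 0 with rfl | hy
    · exact h0
    have hy0 : (0 : ℝ) < y := by exact_mod_cast pos_iff_ne_zero.mpr hy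
    have hsub : Set.Ioo (0 : ℝ) y ⊆ {θ | Λ θ ≤ 0} := by
      intro s hs
      have : (s : EReal) < sSup (Real.toEReal '' {θ : ℝ | Λ θ ≤ 0}) := by
        refine lt_of_lt_of_le ?_ h
        exact EReal.coe_lt_coe_iff.mpr hs.2
      obtain ⟨_, ⟨t, ht, rfl⟩, hst⟩ := lt_sSup_iff.mp this
      exact hdown s t hs.1.le (by exact_mod_cast hst.le) ht
    have := closure_minimal hsub hcl
    rw [closure_Ioo hy0.ne] at this
    exact this ⟨hy0.le, le_rfl⟩
  · intro h
    exact le_sSup ⟨(y : ℝ), h, rfl⟩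

theorem cgfEstimator_nonpos_iff {Ω : Type*} (X : ℕ → Ω → ℝ) {B : ℕ} (hB : 1 ≤ B) (n : ℕ) (ω : Ω)
    (θ : ℝ) : cgfEstimator X B n ω θ ≤ 0 ↔
      ∑ i ∈ Finset.range (n / B), (Real.exp (θ * block X B i ω) - 1) ≤ 0 := by
  unfold cgfEstimator
  rcases Nat.eq_zero_or_pos (n / B) with h | h
  · simp [h]
  have hB' : (0 : ℝ) < (B : ℝ)⁻¹ := by positivity
  have hm : (0 : ℝ) < ((n / B : ℕ) : ℝ) := by exact_mod_cast h
  rw [← not_lt, mul_pos_iff_of_pos_left hB', not_lt, Real.log_nonpos_iff (by positivity),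
    inv_mul_le_iff₀ hm, Finset.sum_sub_distrib]
  simp

/-- The estimator reaches a level if and only if a sum of one term per block is nonpositive. If no
block is complete, the estimator is `∞` and the sum is empty, so that the equivalence still holds. -/
theorem coe_le_exponentEstimator_iff {Ω : Type*} (X : ℕ → Ω → ℝ) {B : ℕ} (hB : 1 ≤ B) (n : ℕ)
    (ω : Ω) (y : ℝ≥0) : (y : ℝ≥0∞) ≤ exponentEstimator X B n ω ↔
      ∑ i ∈ Finset.range (n / B), (Real.exp (y * block X B i ω) - 1) ≤ 0 := by
  have key (θ : ℝ) : ((cgfEstimator X B n ω θ : ℝ) : EReal) ≤ 0 ↔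
      ∑ i ∈ Finset.range (n / B), (Real.exp (θ * block X B i ω) - 1) ≤ 0 := by
    rw [← cgfEstimator_nonpos_iff X hB, EReal.coe_nonpos]
  rw [exponentEstimator, coe_le_tailExponent_iff, key]
  · rw [key]; simp
  · intro s t hs hst ht
    rw [key] at ht ⊢
    rcases (hs.trans hst).eq_or_lt with h | h
    · obtain rfl : s = t := le_antisymm hst (h ▸ hs)
      exact ht
    · calc _ ≤ ∑ i ∈ Finset.range (n / B), s / t * (Real.exp (t * block X B i ω) - 1) :=
            Finset.sum_le_sum fun i _ => exp_mul_le_of_le hs hst h _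
        _ ≤ 0 := by
          rw [← Finset.mul_sum]
          exact mul_nonpos_of_nonneg_of_nonpos (by positivity) ht
  · simp only [key]
    exact isClosed_le (by fun_prop) continuous_const

theorem measurable_block {Ω : Type*} [MeasurableSpace Ω] {X : ℕ → Ω → ℝ}
    (hX : ∀ j, Measurable (X j)) (B i : ℕ) : Measurable (block X B i) := by
  unfold block
  fun_prop

theorem measurable_exponentEstimator {Ω : Type*} [MeasurableSpace Ω] {X : ℕ → Ω → ℝ}
    (hX : ∀ j, Measurable (X j)) {B : ℕ} (hB : 1 ≤ B) (n : ℕ) :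
    Measurable (exponentEstimator X B n) := by
  have hY := measurable_block hX B
  have hy (y : ℝ≥0) : MeasurableSet {ω | (y : ℝ≥0∞) ≤ exponentEstimator X B n ω} := by
    simp only [coe_le_exponentEstimator_iff X hB]
    exact measurableSet_le (by fun_prop) measurable_const
  refine measurable_of_Ici fun a => ?_
  induction a with
  | coe y => exact hy y
  | top =>
    have : exponentEstimator X B n ⁻¹' Set.Ici ∞ =
        ⋂ k : ℕ, {ω | ((k : ℝ≥0) : ℝ≥0∞) ≤ exponentEstimator X B n ω} := by
      ext ω
      simp only [Set.mem_preimage, Set.mem_Ici, top_le_iff, Set.mem_iInter, Set.mem_ofPred_eq]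
      refine ⟨fun h k => h ▸ le_top, fun h => ENNReal.eq_top_of_forall_nnreal_le fun r => ?_⟩
      obtain ⟨k, hk⟩ := exists_nat_ge r
      exact le_trans (by exact_mod_cast hk) (h k)
    rw [this]
    exact MeasurableSet.iInter fun k => hy k

section Exponent

variable {Ω : Type*} [MeasurableSpace Ω] {P : Measure Ω} [IsProbabilityMeasure P] {V : Ω → ℝ}
  {S : Set ℝ}

theorem integrable_comp_of_isCompact (hV : Measurable V) (hS : IsCompact S)
    (hVS : ∀ᵐ ω ∂P, V ω ∈ S) {f : ℝ → ℝ} (hf : Continuous f) :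
    Integrable (fun ω => f (V ω)) P := by
  obtain ⟨C, hC⟩ := hS.exists_bound_of_continuousOn hf.continuousOn
  refine Integrable.of_bound (hf.measurable.comp hV).aestronglyMeasurable C ?_
  filter_upwards [hVS] with ω hω using hC _ hω

/-- The counterpart of `coe_le_exponentEstimator_iff` for the true distribution; `Λ` stands for the
block cumulant generating function, of which only the sign matters. -/
theorem coe_le_tailExponent_mgf_iff (hV : Measurable V) (hS : IsCompact S)
    (hVS : ∀ᵐ ω ∂P, V ω ∈ S) {Λ : ℝ → ℝ} (hΛ : ∀ θ, Λ θ ≤ 0 ↔ mgf V P θ ≤ 1) (y : ℝ≥0) :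
    (y : ℝ≥0∞) ≤ tailExponent (fun θ => (Λ θ : EReal)) ↔ mgf V P y ≤ 1 := by
  have hint (θ : ℝ) : Integrable (fun ω => Real.exp (θ * V ω)) P :=
    integrable_comp_of_isCompact hV hS hVS (f := fun v => Real.exp (θ * v)) (by fun_prop)
  rw [coe_le_tailExponent_iff, EReal.coe_nonpos, hΛ]
  · rw [EReal.coe_nonpos, hΛ, mgf_zero]
  · intro s t hs hst
    rw [EReal.coe_nonpos, EReal.coe_nonpos, hΛ, hΛ]
    intro ht
    rcases (hs.trans hst).eq_or_lt with h | h
    · obtain rfl : s = t := le_antisymm hst (h ▸ hs)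
      exact ht
    have h1 : ∫ ω, (Real.exp (s * V ω) - 1) ∂P ≤ ∫ ω, s / t * (Real.exp (t * V ω) - 1) ∂P :=
      integral_mono ((hint s).sub (integrable_const _))
        (((hint t).sub (integrable_const _)).const_mul _) fun ω => exp_mul_le_of_le hs hst h _
    rw [integral_const_mul, integral_sub (hint s) (integrable_const _),
      integral_sub (hint t) (integrable_const _)] at h1
    simp only [integral_const, probReal_univ, smul_eq_mul, mul_one] at h1
    have h2 : s / t * (mgf V P t - 1) ≤ 0 :=
      mul_nonpos_of_nonneg_of_nonpos (by positivity) (by linarith)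
    have : mgf V P s - 1 ≤ 0 := h1.trans h2
    linarith
  · simp only [EReal.coe_nonpos, hΛ]
    exact isClosed_le (continuous_mgf hint) continuous_const

theorem mgf_lt_one_of_mgf_le_one (hV : Measurable V) (hS : IsCompact S) (h0 : (0 : ℝ) ∉ S)
    (hVS : ∀ᵐ ω ∂P, V ω ∈ S) {s t : ℝ} (hs : 0 < s) (hst : s < t) (ht : mgf V P t ≤ 1) :
    mgf V P s < 1 := by
  have hint (θ : ℝ) : Integrable (fun ω => Real.exp (θ * V ω)) P :=
    integrable_comp_of_isCompact hV hS hVS (f := fun v => Real.exp (θ * v)) (by fun_prop)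
  obtain ⟨δ, hδ, h⟩ := exists_exp_mul_add_le hS h0 hs hst
  have h1 : ∫ ω, (Real.exp (s * V ω) - (1 - δ)) ∂P ≤ ∫ ω, s / t * (Real.exp (t * V ω) - 1) ∂P := by
    refine integral_mono_ae ((hint s).sub (integrable_const _))
        (((hint t).sub (integrable_const _)).const_mul _) ?_
    filter_upwards [hVS] with ω hω
    linarith [h _ hω]
  rw [integral_const_mul, integral_sub (hint s) (integrable_const _),
    integral_sub (hint t) (integrable_const _)] at h1
  simp only [integral_const, probReal_univ, smul_eq_mul, one_mul, mul_one] at h1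
  have h2 : s / t * (mgf V P t - 1) ≤ 0 :=
    mul_nonpos_of_nonneg_of_nonpos (div_nonneg hs.le (hs.trans hst).le) (by linarith)
  have : mgf V P s - (1 - δ) ≤ 0 := h1.trans h2
  linarith

end Exponent

/-! ### Half-line probabilities of sums of i.i.d. variables -/

section IID

variable {Ω : Type*} [MeasurableSpace Ω] {P : Measure Ω} {W : ℕ → Ω → ℝ}

/-- The probability that a sum of i.i.d. variables lies in a set closed under addition is
supermultiplicative in the number of summands. -/
theorem prob_sum_mem_mul_le (hW : ∀ i, Measurable (W i)) (hindep : iIndepFun W P)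
    (hident : ∀ i, IdentDistrib (W i) (W 0) P P) {H : Set ℝ} (hH : MeasurableSet H)
    (hadd : ∀ a ∈ H, ∀ b ∈ H, a + b ∈ H) (m n : ℕ) :
    P {ω | ∑ i ∈ Finset.range m, W i ω ∈ H} * P {ω | ∑ i ∈ Finset.range n, W i ω ∈ H} ≤
      P {ω | ∑ i ∈ Finset.range (m + n), W i ω ∈ H} := by
  have hshift : IdentDistrib (fun ω => ∑ i ∈ Finset.range n, W (m + i) ω)
      (fun ω => ∑ i ∈ Finset.range n, W i ω) P P := by
    have h := IdentDistrib.pi (fun i => (hident (m + i)).trans (hident i).symm)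
      (hindep.precomp (g := fun i => m + i) (add_right_injective m)) hindep
    exact h.comp (u := fun x : ℕ → ℝ => ∑ i ∈ Finset.range n, x i) (by fun_prop)
  have hind : IndepFun (fun ω => ∑ i ∈ Finset.range m, W i ω)
      (fun ω => ∑ i ∈ Finset.range n, W (m + i) ω) P := by
    have hdisj : Disjoint (Finset.range m) (Finset.Ico m (m + n)) := by
      rw [Finset.range_eq_Ico]
      exact Finset.Ico_disjoint_Ico_consecutive 0 m (m + n)
    have h := (hindep.indepFun_finset _ _ hdisj hW).comp
      (φ := fun x : Finset.range m → ℝ => ∑ i, x i)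
      (ψ := fun x : Finset.Ico m (m + n) → ℝ => ∑ i, x i) (by fun_prop) (by fun_prop)
    convert h using 1
    · ext ω
      exact (Finset.sum_coe_sort (Finset.range m) (fun i => W i ω)).symm
    · ext ω
      refine Eq.trans ?_ (Finset.sum_coe_sort (Finset.Ico m (m + n)) (fun i => W i ω)).symm
      rw [Finset.sum_Ico_eq_sum_range, Nat.add_sub_cancel_left]
  have h1 : P {ω | ∑ i ∈ Finset.range n, W i ω ∈ H} =
      P {ω | ∑ i ∈ Finset.range n, W (m + i) ω ∈ H} := (hshift.measure_mem_eq hH).symm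
  rw [h1]
  refine (hind.measure_inter_preimage_eq_mul H H hH hH).symm.trans_le (measure_mono ?_)
  rintro ω ⟨ha, hb⟩
  change ∑ i ∈ Finset.range (m + n), W i ω ∈ H
  rw [Finset.sum_range_add]
  exact hadd _ ha _ hb

theorem prob_sum_mem_eq_zero (hident : ∀ i, IdentDistrib (W i) (W 0) P P) {H : Set ℝ}
    (hH : MeasurableSet H) (hadd : ∀ a ∉ H, ∀ b ∉ H, a + b ∉ H)
    (h0 : P {ω | W 0 ω ∈ H} = 0) {n : ℕ} (hn : 1 ≤ n) :
    P {ω | ∑ i ∈ Finset.range n, W i ω ∈ H} = 0 := by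
  have hall : ∀ᵐ ω ∂P, ∀ i, W i ω ∉ H := by
    rw [ae_all_iff]
    intro i
    have h : P (W i ⁻¹' H) = 0 := ((hident i).measure_mem_eq hH).trans h0
    exact measure_eq_zero_iff_ae_notMem.mp h
  refine measure_eq_zero_iff_ae_notMem.mpr ?_
  filter_upwards [hall] with ω hcon hω
  induction n, hn using Nat.le_induction with
  | base => exact hcon 0 (by simpa using hω)
  | succ n hn ih =>
    by_cases h : ∑ i ∈ Finset.range n, W i ω ∈ H
    · exact ih h
    · have hω' : ∑ i ∈ Finset.range (n + 1), W i ω ∈ H := hω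
      rw [Finset.sum_range_succ] at hω'
      exact hadd _ h _ (hcon n) hω'

variable [IsProbabilityMeasure P]

theorem exists_tendsto_log_prob_sum_mem (hW : ∀ i, Measurable (W i)) (hindep : iIndepFun W P)
    (hident : ∀ i, IdentDistrib (W i) (W 0) P P) {H : Set ℝ} (hH : MeasurableSet H)
    (hadd : ∀ a ∈ H, ∀ b ∈ H, a + b ∈ H) (hadd' : ∀ a ∉ H, ∀ b ∉ H, a + b ∉ H) :
    ∃ r : ℝ≥0∞, Tendsto (fun n : ℕ =>
      ENNReal.log (P {ω | ∑ i ∈ Finset.range n, W i ω ∈ H}) / (n : EReal)) atTop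
      (𝓝 (-(r : EReal))) := by
  refine exists_tendsto_log_div_of_supermultiplicative
    (u := fun n => P {ω | ∑ i ∈ Finset.range n, W i ω ∈ H})
    (prob_sum_mem_mul_le hW hindep hident hH hadd) (fun n => prob_le_one) fun h n hn => ?_
  exact prob_sum_mem_eq_zero hident hH hadd' (by simpa using h) hn

/-- By Hoeffding's inequality, sums of bounded i.i.d. variables with negative mean are nonnegative
only with exponentially small probability. -/
theorem expGrowthSup_prob_sum_nonneg_neg (hW : ∀ i, Measurable (W i)) (hindep : iIndepFun W P)
    (hident : ∀ i, IdentDistrib (W i) (W 0) P P) {C : ℝ} (hC : ∀ i, ∀ᵐ ω ∂P, |W i ω| ≤ C)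
    (hneg : ∫ ω, W 0 ω ∂P < 0) :
    ExpGrowth.expGrowthSup (fun n => P {ω | 0 ≤ ∑ i ∈ Finset.range n, W i ω}) < 0 := by
  have hC0 : 0 ≤ C := by
    obtain ⟨ω, hω⟩ := (hC 0).exists
    exact (abs_nonneg _).trans hω
  set e := ∫ ω, W 0 ω ∂P with he
  -- The upper end `C + 1` instead of `C` keeps the variance proxy positive when `C = 0`.
  set c : ℝ≥0 := (‖(C + 1) - (-C)‖₊ / 2) ^ 2 with hc
  have hc0 : (0 : ℝ) < c := by
    have : (0 : ℝ) < ‖(C + 1) - (-C)‖ := norm_pos_iff.mpr (by linarith)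
    simp only [hc, NNReal.coe_pow, NNReal.coe_div, coe_nnnorm]
    positivity
  have hsub (i : ℕ) : HasSubgaussianMGF (fun ω => W i ω - e) c P := by
    have hi : ∫ ω, W i ω ∂P = e := (hident i).integral_eq
    rw [← hi]
    refine hasSubgaussianMGF_of_mem_Icc (hW i).aemeasurable ?_
    filter_upwards [hC i] with ω hω
    exact ⟨(abs_le.mp hω).1, by linarith [(abs_le.mp hω).2]⟩
  have hind : iIndepFun (fun i ω => W i ω - e) P :=
    hindep.comp (fun _ x => x - e) fun _ => by fun_prop
  have hbound (n : ℕ) : P {ω | 0 ≤ ∑ i ∈ Finset.range n, W i ω} ≤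
      EReal.exp ((-(e ^ 2 / (2 * c)) : ℝ) * n) := by
    have h := HasSubgaussianMGF.measure_sum_range_ge_le_of_iIndepFun hind (n := n)
      (fun i _ => hsub i) (ε := n * -e) (mul_nonneg n.cast_nonneg (by linarith))
    have hset : {ω | (n : ℝ) * -e ≤ ∑ i ∈ Finset.range n, (W i ω - e)} =
        {ω | 0 ≤ ∑ i ∈ Finset.range n, W i ω} := by
      ext ω
      simp only [Set.mem_ofPred_eq, Finset.sum_sub_distrib, Finset.sum_const, Finset.card_range,
        nsmul_eq_mul]
      constructor <;> intro h <;> linarith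
    have hexp : -((n : ℝ) * -e) ^ 2 / (2 * n * c) = -(e ^ 2 / (2 * c)) * n := by
      rcases eq_or_ne n 0 with rfl | hn
      · simp
      · have : (n : ℝ) ≠ 0 := by exact_mod_cast hn
        field_simp
    rw [hset, hexp] at h
    rw [show (((-(e ^ 2 / (2 * c)) : ℝ) : EReal) * (n : EReal)) =
      ((-(e ^ 2 / (2 * c)) * n : ℝ) : EReal) by push_cast; rfl, EReal.exp_coe]
    exact (ENNReal.le_ofReal_iff_toReal_le (measure_ne_top _ _) (Real.exp_nonneg _)).mpr h
  refine (Eventually.expGrowthSup_le (Eventually.of_forall hbound)).trans_lt ?_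
  have : 0 < e ^ 2 / (2 * (c : ℝ)) := by
    have : 0 < e ^ 2 := by nlinarith
    positivity
  exact_mod_cast neg_lt_zero.mpr this

end IID

/-! ### Time changes -/

/-- The exponential rate along `k` is multiplied by the asymptotic slope `c` of `k`. -/
theorem tendsto_log_comp_div {u : ℕ → ℝ≥0∞} {r : ℝ≥0∞}
    (hu : Tendsto (fun n : ℕ => ENNReal.log (u n) / (n : EReal)) atTop (𝓝 (-(r : EReal))))
    {k : ℕ → ℕ} (hk : Tendsto k atTop atTop) {c : ℝ} (hc : 0 < c)
    (hkc : Tendsto (fun n => (k n : ℝ) / n) atTop (𝓝 c)) :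
    Tendsto (fun n : ℕ => ENNReal.log (u (k n)) / (n : EReal)) atTop
      (𝓝 (-((r * ENNReal.ofReal c : ℝ≥0∞) : EReal))) := by
  have h1 := hu.comp hk
  have h2 := (continuous_coe_real_ereal.tendsto c).comp hkc
  have hc' : (c : EReal) ≠ 0 := by exact_mod_cast hc.ne'
  have h3 := (EReal.continuousAt_mul (p := (-(r : EReal), (c : EReal)))
    (Or.inr (EReal.coe_ne_bot c)) (Or.inr (EReal.coe_ne_top c)) (Or.inr hc')
    (Or.inr hc')).tendsto.comp (h1.prodMk_nhds h2)
  have e : -((r * ENNReal.ofReal c : ℝ≥0∞) : EReal) = -(r : EReal) * (c : EReal) := by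
    rw [EReal.coe_ennreal_mul, EReal.coe_ennreal_ofReal, max_eq_left hc.le, EReal.neg_mul]
  rw [e]
  refine h3.congr' ?_
  filter_upwards [hk.eventually (eventually_ge_atTop 1)] with n hn
  have hn' : ((k n : ℕ) : EReal) ≠ 0 := by exact_mod_cast (show k n ≠ 0 by omega)
  change ENNReal.log (u (k n)) / (k n : EReal) * (((k n : ℝ) / (n : ℝ) : ℝ) : EReal) = _
  rw [EReal.coe_div]
  change ENNReal.log (u (k n)) / (k n : EReal) * ((k n : EReal) / (n : EReal)) = _
  rw [EReal.mul_div, EReal.div_mul_cancel (EReal.natCast_ne_bot _) (EReal.natCast_ne_top _) hn']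

/-- If `v` after `N j` steps is dominated by `u` after `(N + 1) j` steps, then `(N + 1) r ≤ N s` for
their rates, whence `r < s` except in the degenerate cases. -/
theorem rate_lt_of_le_comp {u v : ℕ → ℝ≥0∞} {r s : ℝ≥0∞}
    (hu : Tendsto (fun n : ℕ => ENNReal.log (u n) / (n : EReal)) atTop (𝓝 (-(r : EReal))))
    (hv : Tendsto (fun n : ℕ => ENNReal.log (v n) / (n : EReal)) atTop (𝓝 (-(s : EReal))))
    {N : ℕ} (hN : 1 ≤ N) (huv : ∀ j, v (N * j) ≤ u (N * j + j)) (hs : s ≠ 0) (hr : r ≠ ∞) :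
    r < s := by
  have hNR : (0 : ℝ) < N := by exact_mod_cast hN
  have h1 := tendsto_log_comp_div hu (k := fun j => N * j + j) (c := N + 1)
    (tendsto_atTop_mono (fun j => Nat.le_add_left j _) tendsto_id) (by positivity) (by
      refine tendsto_const_nhds.congr' ?_
      filter_upwards [eventually_ge_atTop 1] with j hj
      have : (j : ℝ) ≠ 0 := by exact_mod_cast (show j ≠ 0 by omega)
      push_cast
      field_simp)
  have h2 := tendsto_log_comp_div hv (k := fun j => N * j) (c := N)
    (tendsto_atTop_mono (fun j => Nat.le_mul_of_pos_left j hN) tendsto_id) hNR (by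
      refine tendsto_const_nhds.congr' ?_
      filter_upwards [eventually_ge_atTop 1] with j hj
      have : (j : ℝ) ≠ 0 := by exact_mod_cast (show j ≠ 0 by omega)
      push_cast
      field_simp)
  have h3 := le_of_tendsto_of_tendsto' h2 h1 fun j =>
    EReal.div_le_div_right_of_nonneg (by positivity) (ENNReal.log_le_log (huv j))
  rw [EReal.neg_le_neg_iff, EReal.coe_ennreal_le_coe_ennreal_iff] at h3
  by_contra! hcon
  have hs' : s ≠ ∞ := (hcon.trans_lt (lt_top_iff_ne_top.mpr hr)).ne
  have h4 : s * ENNReal.ofReal (N + 1) ≤ s * ENNReal.ofReal N :=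
    (mul_le_mul_left hcon _).trans h3
  rw [ENNReal.mul_le_mul_iff_right hs hs', ENNReal.ofReal_le_ofReal_iff hNR.le] at h4
  linarith

theorem tendsto_natDiv_div {B : ℕ} :
    Tendsto (fun n : ℕ => ((n / B : ℕ) : ℝ) / n) atTop (𝓝 ((B : ℝ)⁻¹)) := by
  have h := (tendsto_nat_floor_mul_div_atTop (R := ℝ) (a := (B : ℝ)⁻¹) (by positivity)).comp
    tendsto_natCast_atTop_atTop
  refine h.congr fun n => ?_
  simp only [Function.comp]
  rw [inv_mul_eq_div, Nat.floor_div_eq_div]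

/-! ### Comparison of the empirical moment generating functions -/

/-- If the empirical moment generating function of `N j` blocks is at most `1` at `z`, then at a
smaller `y` it stays at most `1` after `j` further blocks with arbitrary values in `S`. -/
theorem exists_sum_exp_nonpos_of_sum_exp_nonpos {S : Set ℝ} (hS : IsCompact S)
    (h0 : (0 : ℝ) ∉ S) {y z : ℝ} (hy : 0 < y) (hyz : y < z) :
    ∃ N : ℕ, 1 ≤ N ∧ ∀ a : ℕ → ℝ, (∀ i, a i ∈ S) → ∀ j : ℕ,
      ∑ i ∈ Finset.range (N * j), (Real.exp (z * a i) - 1) ≤ 0 →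
        ∑ i ∈ Finset.range (N * j + j), (Real.exp (y * a i) - 1) ≤ 0 := by
  obtain ⟨δ, hδ, h⟩ := exists_exp_mul_add_le hS h0 hy hyz
  obtain ⟨C, hC⟩ := hS.exists_bound_of_continuousOn (f := fun w => Real.exp (y * w) - 1)
    (by fun_prop)
  obtain ⟨N, hN⟩ := exists_nat_ge (max 1 (C / δ))
  refine ⟨N, by exact_mod_cast (le_max_left _ _).trans hN, fun a ha j hz => ?_⟩
  have hNC : C ≤ N * δ := (div_le_iff₀ hδ).mp ((le_max_right _ _).trans hN)
  have h1 : ∑ i ∈ Finset.range (N * j), (Real.exp (y * a i) - 1 + δ) ≤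
      ∑ i ∈ Finset.range (N * j), y / z * (Real.exp (z * a i) - 1) :=
    Finset.sum_le_sum fun i _ => h _ (ha i)
  have h2 : ∑ i ∈ Finset.range j, (Real.exp (y * a (N * j + i)) - 1) ≤ ∑ i ∈ Finset.range j, C :=
    Finset.sum_le_sum fun i _ => (le_abs_self _).trans (hC _ (ha _))
  have h3 : y / z * ∑ i ∈ Finset.range (N * j), (Real.exp (z * a i) - 1) ≤ 0 :=
    mul_nonpos_of_nonneg_of_nonpos (div_nonneg hy.le (hy.trans hyz).le) hz
  rw [← Finset.mul_sum, Finset.sum_add_distrib] at h1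
  simp only [Finset.sum_const, Finset.card_range, nsmul_eq_mul, Nat.cast_mul] at h1 h2
  rw [Finset.sum_range_add]
  nlinarith [mul_le_mul_of_nonneg_left hNC (Nat.cast_nonneg (α := ℝ) j)]

/-- If the empirical moment generating function of `N j` blocks exceeds `1` at `y`, then at a larger
`z` it still exceeds `1` after `j` further blocks with arbitrary values in `S`. -/
theorem exists_sum_exp_pos_of_sum_exp_pos {S : Set ℝ} (hS : IsCompact S)
    (h0 : (0 : ℝ) ∉ S) {y z : ℝ} (hy : 0 < y) (hyz : y < z) :
    ∃ N : ℕ, 1 ≤ N ∧ ∀ a : ℕ → ℝ, (∀ i, a i ∈ S) → ∀ j : ℕ,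
      0 < ∑ i ∈ Finset.range (N * j), (Real.exp (y * a i) - 1) →
        0 < ∑ i ∈ Finset.range (N * j + j), (Real.exp (z * a i) - 1) := by
  obtain ⟨δ, hδ, h⟩ := exists_exp_mul_add_le hS h0 hy hyz
  obtain ⟨N, hN⟩ := exists_nat_ge (max 1 (1 / δ))
  refine ⟨N, by exact_mod_cast (le_max_left _ _).trans hN, fun a ha j hpos => ?_⟩
  have hN1 : 1 ≤ N * δ := (div_le_iff₀ hδ).mp ((le_max_right _ _).trans hN)
  have h1 : ∑ i ∈ Finset.range (N * j), (Real.exp (y * a i) - 1 + δ) ≤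
      ∑ i ∈ Finset.range (N * j), y / z * (Real.exp (z * a i) - 1) :=
    Finset.sum_le_sum fun i _ => h _ (ha i)
  have h2 : ∑ i ∈ Finset.range j, (-1 : ℝ) ≤
      ∑ i ∈ Finset.range j, (Real.exp (z * a (N * j + i)) - 1) :=
    Finset.sum_le_sum fun i _ => by linarith [Real.exp_pos (z * a (N * j + i))]
  rw [← Finset.mul_sum, Finset.sum_add_distrib] at h1
  simp only [Finset.sum_const, Finset.card_range, nsmul_eq_mul, Nat.cast_mul] at h1 h2
  rw [Finset.sum_range_add]
  set T := ∑ i ∈ Finset.range (N * j), (Real.exp (z * a i) - 1)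
  have hj : (j : ℝ) ≤ N * j * δ := by
    nlinarith [mul_le_mul_of_nonneg_left hN1 (Nat.cast_nonneg (α := ℝ) j)]
  have hyz0 : 0 < y / z := div_pos hy (hy.trans hyz)
  have hyz1 : y / z ≤ 1 := (div_le_one (hy.trans hyz)).mpr hyz.le
  have hT' : (j : ℝ) < y / z * T := by linarith
  have hT : 0 < T := by
    have : 0 < y / z * T := (Nat.cast_nonneg j).trans_lt hT'
    exact (mul_pos_iff_of_pos_left hyz0).mp this
  nlinarith

/-! ### The scaled cumulant generating function along multiples of the block length -/

theorem partialSum_mul {Ω : Type*} (X : ℕ → Ω → ℝ) (B k : ℕ) :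
    partialSum X (k * B) = ∑ i ∈ Finset.range k, block X B i := by
  ext ω
  rw [Finset.sum_apply]
  induction k with
  | zero => simp [partialSum]
  | succ k ih =>
    rw [Finset.sum_range_succ, ← ih]
    simp only [partialSum, block]
    rw [Nat.succ_mul, Finset.sum_range_add]

theorem blockCGF_nonpos_iff {Ω : Type*} [MeasurableSpace Ω] {P : Measure Ω} {X : ℕ → Ω → ℝ}
    {B : ℕ} (hB : 1 ≤ B) (θ : ℝ) : blockCGF P X B θ ≤ 0 ↔ mgf (block X B 0) P θ ≤ 1 := by
  have hB' : (0 : ℝ) < (B : ℝ)⁻¹ := by positivity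
  rw [blockCGF, cgf, ← not_lt, mul_pos_iff_of_pos_left hB', not_lt, Real.log_nonpos_iff mgf_nonneg]

theorem scaledCGF_mul {Ω : Type*} [MeasurableSpace Ω] {P : Measure Ω} [IsProbabilityMeasure P]
    {X : ℕ → Ω → ℝ} (hX : ∀ j, Measurable (X j)) {B : ℕ} (hB : 1 ≤ B)
    (hindep : iIndepFun (fun i : ℕ => block X B i) P)
    (hident : ∀ i : ℕ, IdentDistrib (block X B i) (block X B 0) P P) {θ : ℝ}
    (hint : ∀ i, Integrable (fun ω => Real.exp (θ * block X B i ω)) P) {k : ℕ} (hk : 1 ≤ k) :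
    scaledCGF P X (k * B) θ = (blockCGF P X B θ : EReal) := by
  have hmeas := measurable_block hX B
  have hsum : mgf (partialSum X (k * B)) P θ = mgf (block X B 0) P θ ^ k := by
    rw [partialSum_mul, mgf_sum_of_identDistrib hmeas hindep
      (fun i _ j _ => (hident i).trans (hident j).symm) (Finset.mem_range.mpr hk),
      Finset.card_range]
  have hsint : Integrable (fun ω => Real.exp (θ * partialSum X (k * B) ω)) P := by
    rw [partialSum_mul]
    exact hindep.integrable_exp_mul_sum hmeas fun i _ => hint i
  have hpos : 0 < mgf (block X B 0) P θ := mgf_pos (hint 0)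
  rw [scaledCGF, ← ofReal_integral_eq_lintegral_ofReal hsint
    (Eventually.of_forall fun ω => (Real.exp_pos _).le)]
  change ENNReal.log (ENNReal.ofReal (mgf (partialSum X (k * B)) P θ)) / _ = _
  rw [hsum, ENNReal.log_ofReal_of_pos (pow_pos hpos k), Real.log_pow, blockCGF, cgf]
  rw [show ((k * B : ℕ) : EReal) = (((k * B : ℕ) : ℝ) : EReal) from rfl, ← EReal.coe_div]
  have : (k : ℝ) ≠ 0 := by exact_mod_cast (show k ≠ 0 by omega)
  have : (B : ℝ) ≠ 0 := by exact_mod_cast (show B ≠ 0 by omega)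
  congr 1
  push_cast
  field_simp

/-! ### Rates of the half-line events -/

section Rates

variable {Ω : Type*} [MeasurableSpace Ω] {P : Measure Ω} {Y : ℕ → Ω → ℝ} {S : Set ℝ}

theorem rate_nonpos_lt (hS : IsCompact S) (h0 : (0 : ℝ) ∉ S) (hYS : ∀ i, ∀ᵐ ω ∂P, Y i ω ∈ S)
    {y z : ℝ} (hy : 0 < y) (hyz : y < z) {r s : ℝ≥0∞}
    (hr : Tendsto (fun n : ℕ => ENNReal.log
      (P {ω | ∑ i ∈ Finset.range n, (Real.exp (y * Y i ω) - 1) ≤ 0}) / (n : EReal)) atTop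
      (𝓝 (-(r : EReal))))
    (hs : Tendsto (fun n : ℕ => ENNReal.log
      (P {ω | ∑ i ∈ Finset.range n, (Real.exp (z * Y i ω) - 1) ≤ 0}) / (n : EReal)) atTop
      (𝓝 (-(s : EReal)))) (hs0 : s ≠ 0) (hrt : r ≠ ∞) : r < s := by
  obtain ⟨N, hN, h⟩ := exists_sum_exp_nonpos_of_sum_exp_nonpos hS h0 hy hyz
  refine rate_lt_of_le_comp hr hs hN (fun j => measure_mono_ae ?_) hs0 hrt
  filter_upwards [ae_all_iff.mpr hYS] with ω hω using h (fun i => Y i ω) hω j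

theorem rate_pos_lt (hS : IsCompact S) (h0 : (0 : ℝ) ∉ S) (hYS : ∀ i, ∀ᵐ ω ∂P, Y i ω ∈ S)
    {y z : ℝ} (hy : 0 < y) (hyz : y < z) {r s : ℝ≥0∞}
    (hr : Tendsto (fun n : ℕ => ENNReal.log
      (P {ω | 0 < ∑ i ∈ Finset.range n, (Real.exp (z * Y i ω) - 1)}) / (n : EReal)) atTop
      (𝓝 (-(r : EReal))))
    (hs : Tendsto (fun n : ℕ => ENNReal.log
      (P {ω | 0 < ∑ i ∈ Finset.range n, (Real.exp (y * Y i ω) - 1)}) / (n : EReal)) atTop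
      (𝓝 (-(s : EReal)))) (hs0 : s ≠ 0) (hrt : r ≠ ∞) : r < s := by
  obtain ⟨N, hN, h⟩ := exists_sum_exp_pos_of_sum_exp_pos hS h0 hy hyz
  refine rate_lt_of_le_comp hr hs hN (fun j => measure_mono_ae ?_) hs0 hrt
  filter_upwards [ae_all_iff.mpr hYS] with ω hω using h (fun i => Y i ω) hω j

variable [IsProbabilityMeasure P]

theorem integral_exp_sub_one (hY : ∀ i, Measurable (Y i)) (hS : IsCompact S)
    (hYS : ∀ i, ∀ᵐ ω ∂P, Y i ω ∈ S) (y : ℝ) :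
    ∫ ω, (Real.exp (y * Y 0 ω) - 1) ∂P = mgf (Y 0) P y - 1 := by
  rw [integral_sub (integrable_comp_of_isCompact (hY 0) hS (hYS 0)
    (f := fun v => Real.exp (y * v)) (by fun_prop)) (integrable_const _)]
  simp [mgf]

theorem rate_nonpos_ne_zero (hY : ∀ i, Measurable (Y i)) (hindep : iIndepFun Y P)
    (hident : ∀ i, IdentDistrib (Y i) (Y 0) P P) (hS : IsCompact S)
    (hYS : ∀ i, ∀ᵐ ω ∂P, Y i ω ∈ S) {y : ℝ} (hy : 1 < mgf (Y 0) P y) {r : ℝ≥0∞}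
    (hr : Tendsto (fun n : ℕ => ENNReal.log
      (P {ω | ∑ i ∈ Finset.range n, (Real.exp (y * Y i ω) - 1) ≤ 0}) / (n : EReal)) atTop
      (𝓝 (-(r : EReal)))) : r ≠ 0 := by
  obtain ⟨C, hC⟩ := hS.exists_bound_of_continuousOn (f := fun w => -(Real.exp (y * w) - 1))
    (by fun_prop)
  have h := expGrowthSup_prob_sum_nonneg_neg (P := P)
    (W := fun i ω => -(Real.exp (y * Y i ω) - 1)) (fun i => by fun_prop)
    (hindep.comp (fun _ v => -(Real.exp (y * v) - 1)) fun _ => by fun_prop)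
    (fun i => (hident i).comp (u := fun v => -(Real.exp (y * v) - 1)) (by fun_prop))
    (C := C) (fun i => by filter_upwards [hYS i] with ω hω using hC _ hω)
    (by rw [integral_neg, integral_exp_sub_one hY hS hYS]; linarith)
  simp only [Finset.sum_neg_distrib, Left.nonneg_neg_iff] at h
  rw [show ExpGrowth.expGrowthSup _ = _ from hr.limsup_eq] at h
  rintro rfl
  simp at h

theorem rate_pos_ne_zero (hY : ∀ i, Measurable (Y i)) (hindep : iIndepFun Y P)
    (hident : ∀ i, IdentDistrib (Y i) (Y 0) P P) (hS : IsCompact S)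
    (hYS : ∀ i, ∀ᵐ ω ∂P, Y i ω ∈ S) {y : ℝ} (hy : mgf (Y 0) P y < 1) {r : ℝ≥0∞}
    (hr : Tendsto (fun n : ℕ => ENNReal.log
      (P {ω | 0 < ∑ i ∈ Finset.range n, (Real.exp (y * Y i ω) - 1)}) / (n : EReal)) atTop
      (𝓝 (-(r : EReal)))) : r ≠ 0 := by
  obtain ⟨C, hC⟩ := hS.exists_bound_of_continuousOn (f := fun w => Real.exp (y * w) - 1)
    (by fun_prop)
  have h := expGrowthSup_prob_sum_nonneg_neg (P := P)
    (W := fun i ω => Real.exp (y * Y i ω) - 1) (fun i => by fun_prop)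
    (hindep.comp (fun _ v => Real.exp (y * v) - 1) fun _ => by fun_prop)
    (fun i => (hident i).comp (u := fun v => Real.exp (y * v) - 1) (by fun_prop))
    (C := C) (fun i => by filter_upwards [hYS i] with ω hω using hC _ hω)
    (by rw [integral_exp_sub_one hY hS hYS]; linarith)
  have h' : -(r : EReal) ≤ _ := hr.limsup_eq.symm.trans_le
    (ExpGrowth.expGrowthSup_monotone fun n => measure_mono (μ := P)
      fun ω (hω : 0 < ∑ i ∈ Finset.range n, (Real.exp (y * Y i ω) - 1)) => hω.le)
  rintro rfl
  simpa using h'.trans_lt h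

end Rates

end Loynes

theorem theorem3 {Ω : Type*} [MeasurableSpace Ω] (P : Measure Ω) [IsProbabilityMeasure P]
    (X : ℕ → Ω → ℝ) (hX : ∀ j, Measurable (X j))
    (B : ℕ) (hB : 1 ≤ B)
    (hindep : iIndepFun (fun i : ℕ => Loynes.block X B i) P)
    (hident : ∀ i : ℕ, IdentDistrib (Loynes.block X B i) (Loynes.block X B 0) P P)
    (S : Set ℝ) (hSclosed : IsClosed S) (hSbounded : Bornology.IsBounded S)
    (hSzero : ∃ ε : ℝ, 0 < ε ∧ Disjoint (Metric.ball (0 : ℝ) ε) S)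
    (hYS : ∀ i : ℕ, ∀ᵐ ω ∂P, Loynes.block X B i ω ∈ S) :
    (∀ n : ℕ, Measurable (Loynes.exponentEstimator X B n)) ∧
    (∀ θ : ℝ, Tendsto (fun k : ℕ => Loynes.scaledCGF P X (k * B) θ) atTop
      (𝓝 (Loynes.blockCGF P X B θ : EReal))) ∧
    ∃ J : ℝ≥0∞ → ℝ≥0∞,
      Loynes.IsGoodRateFunction J ∧
      Loynes.SatisfiesLDP P (fun n : ℕ => Loynes.exponentEstimator X B n) J ∧
      (∀ x : ℝ≥0∞,
        J x = 0 ↔ x = Loynes.tailExponent (fun θ => (Loynes.blockCGF P X B θ : EReal))) ∧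
      (∀ Λ : ℝ → EReal, Loynes.IsSCGF P X Λ →
        (∀ θ : ℝ, Λ θ = (Loynes.blockCGF P X B θ : EReal)) ∧
        ∀ x : ℝ≥0∞, J x = 0 ↔ x = Loynes.tailExponent Λ) := by
  have hS : IsCompact S := Metric.isCompact_of_isClosed_isBounded hSclosed hSbounded
  have h0 : (0 : ℝ) ∉ S := by
    obtain ⟨ε, hε, hd⟩ := hSzero
    exact Set.disjoint_left.mp hd (Metric.mem_ball_self hε)
  have hY := Loynes.measurable_block hX B
  have hmeas := Loynes.measurable_exponentEstimator hX hB
  have hcgf (θ : ℝ) : Tendsto (fun k : ℕ => Loynes.scaledCGF P X (k * B) θ) atTop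
      (𝓝 (Loynes.blockCGF P X B θ : EReal)) := by
    refine tendsto_const_nhds.congr' ?_
    filter_upwards [eventually_ge_atTop 1] with k hk
    exact (Loynes.scaledCGF_mul hX hB hindep hident (fun i =>
      Loynes.integrable_comp_of_isCompact (hY i) hS (hYS i) (f := fun v => Real.exp (θ * v))
        (by fun_prop)) hk).symm
  have hΛ (Λ : ℝ → EReal) (h : Loynes.IsSCGF P X Λ) (θ : ℝ) :
      Λ θ = (Loynes.blockCGF P X B θ : EReal) :=
    tendsto_nhds_unique ((h θ).comp (tendsto_id.atTop_mul_const' (by omega))) (hcgf θ)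
  set t := Loynes.tailExponent (fun θ => (Loynes.blockCGF P X B θ : EReal)) with ht
  have hle (y : ℝ≥0) : (y : ℝ≥0∞) ≤ t ↔ mgf (Loynes.block X B 0) P y ≤ 1 :=
    Loynes.coe_le_tailExponent_mgf_iff (hY 0) hS (hYS 0) (Loynes.blockCGF_nonpos_iff hB) y
  have hrate (y : ℝ≥0) {H : Set ℝ} (hH : MeasurableSet H) (hadd : ∀ a ∈ H, ∀ b ∈ H, a + b ∈ H)
      (hadd' : ∀ a ∉ H, ∀ b ∉ H, a + b ∉ H) := Loynes.exists_tendsto_log_prob_sum_mem (P := P)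
    (W := fun i ω => Real.exp (y * Loynes.block X B i ω) - 1) (fun i => by fun_prop)
    (hindep.comp (fun _ v => Real.exp (y * v) - 1) fun _ => by fun_prop)
    (fun i => (hident i).comp (u := fun v => Real.exp (y * v) - 1) (by fun_prop)) hH hadd hadd'
  choose U hU using fun y => hrate y (H := Set.Iic 0) measurableSet_Iic
    (fun a ha b hb => by
      rw [Set.mem_Iic] at *; exact add_nonpos ha hb)
    (fun a ha b hb => by
      rw [Set.mem_Iic, not_le] at *; exact add_pos ha hb)
  choose L hL using fun y => hrate y (H := Set.Ioi 0) measurableSet_Ioi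
    (fun a ha b hb => by
      rw [Set.mem_Ioi] at *; exact add_pos ha hb)
    (fun a ha b hb => by
      rw [Set.mem_Ioi, not_lt] at *; exact add_nonpos ha hb)
  simp only [Set.mem_Iic] at hU
  simp only [Set.mem_Ioi] at hL
  set c : ℝ := (B : ℝ)⁻¹ with hc
  have hc0 : 0 < c := by positivity
  have hcE : ENNReal.ofReal c ≠ 0 := by simpa using hc0
  have hdiv : Tendsto (fun n => n / B) atTop atTop := Nat.tendsto_div_const_atTop (by omega)
  have key := Loynes.satisfiesLDP_halfLineRate (P := P) (Z := Loynes.exponentEstimator X B) hmeas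
    (t := t) (U := fun y => U y * ENNReal.ofReal c) (L := fun y => L y * ENNReal.ofReal c)
    (fun y => by
      simp only [Loynes.coe_le_exponentEstimator_iff X hB]
      exact Loynes.tendsto_log_comp_div (hU y) hdiv hc0 Loynes.tendsto_natDiv_div)
    (fun y => by
      simp only [← not_le, Loynes.coe_le_exponentEstimator_iff X hB]
      simp only [not_le]
      exact Loynes.tendsto_log_comp_div (hL y) hdiv hc0 Loynes.tendsto_natDiv_div)
    (fun y z hy hyz hz0 hyt => by
      refine ENNReal.mul_lt_mul_left hcE ENNReal.ofReal_ne_top ?_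
      exact Loynes.rate_nonpos_lt hS h0 hYS (by exact_mod_cast hy) (by exact_mod_cast hyz)
        (hU y) (hU z) (left_ne_zero_of_mul hz0) fun h => hyt (by simp [h, hcE]))
    (fun y z hy hyz hy0 hzt => by
      refine ENNReal.mul_lt_mul_left hcE ENNReal.ofReal_ne_top ?_
      exact Loynes.rate_pos_lt hS h0 hYS (by exact_mod_cast hy) (by exact_mod_cast hyz)
        (hL z) (hL y) (left_ne_zero_of_mul hy0) fun h => hzt (by simp [h, hcE]))
    (fun y hty => mul_ne_zero (Loynes.rate_nonpos_ne_zero hY hindep hident hS hYS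
      (not_le.mp fun h => absurd ((hle y).mpr h) (not_le.mpr hty)) (hU y)) hcE)
    (fun y hyt => by
      refine mul_ne_zero ?_ hcE
      -- The event that the estimator is below `0` is empty, so its rate is infinite.
      rcases eq_or_ne y 0 with rfl | hy
      · intro h
        have := tendsto_nhds_unique (hL 0) (tendsto_const_nhds.congr' (f₁ := fun _ => ⊥) (by
          filter_upwards [eventually_ge_atTop 1] with n hn
          simp [EReal.bot_div_of_pos_ne_top
            (show (0 : EReal) < n by exact_mod_cast hn) (EReal.natCast_ne_top n)]))
        simp [h] at this
      · obtain ⟨z, hyz, hzt⟩ := ENNReal.lt_iff_exists_nnreal_btwn.mp hyt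
        exact Loynes.rate_pos_ne_zero hY hindep hident hS hYS
          (Loynes.mgf_lt_one_of_mgf_le_one (hY 0) hS h0 (hYS 0)
            (by exact_mod_cast pos_iff_ne_zero.mpr hy) (by exact_mod_cast hyz)
            ((hle z).mp hzt.le)) (hL y))
  refine ⟨hmeas, hcgf, _, Loynes.isGoodRateFunction_halfLineRate, key.1, key.2, ?_⟩
  intro Λ h
  refine ⟨hΛ Λ h, fun x => ?_⟩
  rw [funext (hΛ Λ h)]
  exact key.2 x
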